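/- Let $M$ be a smooth manifold of dimension $n$, and let $F:TM\to[0,\infty)$ be a Finsler structure: $F$ is smooth on $TM\setminus 0$, $F(x,\lambda y)=\lambda F(x,y)$ for $\lambda>0$, and $g_{ij}=\tfrac12\,\partial^2(F^2)/\partial y^i\partial y^j$ is positive definite on $TM\setminus0$. In local coordinates $(x^i,y^i)$ induced by a chart of $M$, with indices raised and lowered by $g$, put $A_{ijk}=\tfrac F2\,\partial g_{ij}/\partial y^k$, $\omega_i=\partial F/\partial y^i$, and $$N^k_m=\tfrac14\,\frac{\partial}{\partial y^m}\Big(g^{ks}\big(\tfrac{\partial g_{si}}{\partial x^j}+\tfrac{\partial g_{sj}}{\partial x^i}-\tfrac{\partial g_{ij}}{\partial x^s}\big)y^iy^j\Big).$$ The Chern connection $D$ and the Berwald connection ${}^\flat D$ on the pulled-back tangent bundle $\pi^*(TM)\to TM\setminus0$ have the Christoffel symbols $$\gamma^k_{ij}=\tfrac12g^{ks}\big(\tfrac{\partial g_{si}}{\partial x^j}+\tfrac{\partial g_{sj}}{\partial x^i}-\tfrac{\partial g_{ij}}{\partial x^s}\big)-g^{ks}\big(\tfrac{N^m_j}{F}A_{msi}+\tfrac{N^m_i}{F}A_{msj}-\tfrac{N^m_s}{F}A_{mij}\big),\qquad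 {}^\flat\gamma^k_{ij}=\frac{\partial N^k_i}{\partial y^j}.$$ Let $d_r=u\circ d$, where $u:T^*(TM\setminus0)\to\pi^*(T^*M)$ is a bundle map of the form $u=a\,h+b\,v$; here $a,b$ are functions on $TM$, $h(\theta)_r=\theta(\partial_{x^r}-N^m_r\partial_{y^m})$ is the horizontal projection, and $v(\theta)_r=\theta(\partial_{y^r})$ is the dual of the vertical lift (so $u=h$ and $u=v$ are included). Put $$B^k_{ij}=\big(A^{kr}_i\omega_j+A^{kr}_j\omega_i-A^k_{ij}\omega^r-A^r_{ij}\omega^k-A^k_{is}A^{sr}_j-A^k_{js}A^{sr}_i+A^{rk}_sA^s_{ij}\big)\,d_r(\log F),$$ $${}^\flat B^k_{ij}=\Big(F\,\frac{\partial A^{kr}_i}{\partial y^j}+A^{kr}_i\omega_j+2A^{rk}_j\omega_i\Big)\,d_r(\log F).$$ For $f\in\mathrm{Diff}(M)$ let $f^\ast$ denote the ordinary pull-back by $f$ of tensors, connections and operators (through the lift $Tf$ for objects on $TM\setminus0$), let $\ell(f)=f^\ast\gamma-\gamma$, and let $\mathrm{Sym}_{i,j}$ denote the sum over the two orderings of $i,j$.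 For $\delta\in\mathbb R$ let $\mathcal A(f)$ be the operator that sends a symmetric twice contravariant tensor density $P$ of weight $\delta$ on $M$ to the section $\mathcal A(f)^k_{ij}P^{ij}$ of $\pi^*(TM)$ with values in the $\delta$-densities of $\pi^*(T^*M)$, where $$\begin{aligned}\mathcal A(f)^k_{ij}={}&f^\ast\big(g^{sk}g_{ij}D_s\big)-g^{sk}g_{ij}D_s+(2-\delta n)\Big(\ell(f)^k_{ij}-\tfrac1n\mathrm{Sym}_{i,j}\,\delta^k_i\,\ell(f)^t_{tj}\Big)\\&+W^k_{ij}-f^\ast W^k_{ij}-(2-\delta n)\Big(f^\ast B^k_{ij}-B^k_{ij}-\tfrac1n\mathrm{Sym}_{i,j}\,\delta^k_i\big(f^\ast B^t_{jt}-B^t_{jt}\big)\Big),\\W^k_{ij}={}&g^{kl}\big(\mathrm{Sym}_{i,j}\,g_{sj}B^s_{li}-\delta\,g_{ij}B^t_{lt}\big),\end{aligned}$$ and $D_sP^{ij}=\partial_{x^s}P^{ij}+\gamma^i_{sm}P^{mj}+\gamma^j_{sm}P^{im}-\delta\,\gamma^t_{ts}P^{ij}$. Let ${}^\flat\!\mathcal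 A(f)$ be the operator given by the same formulas with $\gamma,D,B$ replaced by ${}^\flat\gamma,{}^\flat D,{}^\flat B$. If $(M,F)$ is a Landsberg space, i.e. if the tensor $\dot A_{ijk}=-\tfrac12\,y_l\,\dfrac{\partial^2N^l_i}{\partial y^j\partial y^k}$ vanishes identically on $TM\setminus 0$, where $y_l=g_{lm}y^m$, then $\mathcal A(f)={}^\flat\!\mathcal A(f)$ for every $f\in\mathrm{Diff}(M)$ and every $\delta\in\mathbb R$. -/

import Mathlib

open scoped Manifold ContDiff

noncomputable section

namespace Finsler

/-! ### Coordinate calculus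

A point of the coordinate domain of `TM` is a pair `p = (x, y)` of vectors of `ℝⁿ`; `L` denotes the
coordinate expression of the Finsler function. Index conventions: the arguments `k i j` of symbols
such as `Γ L p k i j` stand for `Γ^k_{ij}` at `p`. -/

/-- The coordinate space `ℝⁿ`. -/
abbrev E (n : ℕ) : Type := EuclideanSpace ℝ (Fin n)

variable {n : ℕ}

/-- The standard basis vector `e_i` of `ℝⁿ`. -/
def e (i : Fin n) : E n := EuclideanSpace.single i (1 : ℝ)

/-- `∂h/∂x^i`. -/
def dx (i : Fin n) (h : E n × E n → ℝ) (p : E n × E n) : ℝ := fderiv ℝ h p (e i, 0)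

/-- `∂h/∂y^i`. -/
def dy (i : Fin n) (h : E n × E n → ℝ) (p : E n × E n) : ℝ := fderiv ℝ h p (0, e i)

/-- The Kronecker symbol. -/
def kron (i k : Fin n) : ℝ := if i = k then 1 else 0

/-- The fundamental tensor `g_{ij} = ½ ∂²(L²)/∂y^i∂y^j`, as a matrix. -/
def g (L : E n × E n → ℝ) (p : E n × E n) : Matrix (Fin n) (Fin n) ℝ :=
  Matrix.of fun i j => (1 / 2 : ℝ) * dy i (dy j fun q => L q ^ 2) p

/-- The inverse fundamental tensor `g^{ij}`. -/
def gInv (L : E n × E n → ℝ) (p : E n × E n) : Matrix (Fin n) (Fin n) ℝ := (g L p)⁻¹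

/-- The Cartan tensor `A_{ijk} = (L/2) ∂g_{ij}/∂y^k`. -/
def cartan (L : E n × E n → ℝ) (p : E n × E n) (i j k : Fin n) : ℝ :=
  L p / 2 * dy k (fun q => g L q i j) p

/-- `A^k_{ij} = A_{ijl} g^{lk}`. -/
def cartanUp (L : E n × E n → ℝ) (p : E n × E n) (k i j : Fin n) : ℝ :=
  ∑ l, cartan L p i j l * gInv L p l k

/-- `A^{kr}_i = A_{iab} g^{ak} g^{br}`. -/
def cartanUpUp (L : E n × E n → ℝ) (p : E n × E n) (k r i : Fin n) : ℝ :=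
  ∑ a, ∑ b, cartan L p i a b * gInv L p a k * gInv L p b r

/-- The Hilbert form `ω_i = ∂L/∂y^i`. -/
def hilbert (L : E n × E n → ℝ) (p : E n × E n) (i : Fin n) : ℝ := dy i L p

/-- `ω^k = g^{kl} ω_l`. -/
def hilbertUp (L : E n × E n → ℝ) (p : E n × E n) (k : Fin n) : ℝ :=
  ∑ l, gInv L p k l * hilbert L p l

/-- `∂g_{si}/∂x^j + ∂g_{sj}/∂x^i - ∂g_{ij}/∂x^s`. -/
def firstKind (L : E n × E n → ℝ) (p : E n × E n) (s i j : Fin n) : ℝ :=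
  dx j (fun q => g L q s i) p + dx i (fun q => g L q s j) p - dx s (fun q => g L q i j) p

/-- The nonlinear connection `N^k_m`. -/
def nonlin (L : E n × E n → ℝ) (p : E n × E n) (k m : Fin n) : ℝ :=
  (1 / 4 : ℝ) *
    dy m (fun q => ∑ s, ∑ i, ∑ j, gInv L q k s * firstKind L q s i j * q.2 j * q.2 i) p

/-- The Christoffel symbols `γ^k_{ij}` of the Chern connection. -/
def chern (L : E n × E n → ℝ) (p : E n × E n) (k i j : Fin n) : ℝ :=
  (1 / 2 : ℝ) * ∑ s, gInv L p k s * firstKind L p s i j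
    - ∑ s, gInv L p k s * ∑ m,
        (nonlin L p m j / L p * cartan L p m s i + nonlin L p m i / L p * cartan L p m s j
          - nonlin L p m s / L p * cartan L p m i j)

/-- The Christoffel symbols `♭γ^k_{ij} = ∂N^k_i/∂y^j` of the Berwald connection. -/
def berwald (L : E n × E n → ℝ) (p : E n × E n) (k i j : Fin n) : ℝ :=
  dy j (fun q => nonlin L q k i) p

/-- The Landsberg tensor `Ȧ_{ijk} = -½ y_l ∂²N^l_i/∂y^j∂y^k`, where `y_l = g_{lm} y^m`. -/
def landsberg (L : E n × E n → ℝ) (p : E n × E n) (i j k : Fin n) : ℝ :=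
  -(1 / 2 : ℝ) * ∑ l, (∑ m, g L p l m * p.2 m) * dy j (dy k fun q => nonlin L q l i) p

/-- The bundle map `u = a h + b v : T^*(TM∖0) → π^*(T^*M)`, in coordinates. Here `h` is the projection
onto the horizontal part, `h(θ)_r = θ(∂/∂x^r - N^m_r ∂/∂y^m)`, and `v` is the dual of the vertical
lift, `v(θ)_r = θ(∂/∂y^r)`. -/
def uMap (L a b : E n × E n → ℝ) (p : E n × E n) (θ : E n × E n →L[ℝ] ℝ) (r : Fin n) : ℝ :=
  a p * (θ (e r, 0) - ∑ m, nonlin L p m r * θ (0, e m)) + b p * θ (0, e r)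

/-- `d_r (log L)`, where `d_r = u ∘ d`. -/
def dLog (L a b : E n × E n → ℝ) (p : E n × E n) (r : Fin n) : ℝ :=
  uMap L a b p (fderiv ℝ (fun q => Real.log (L q)) p) r

/-- The tensor `B^k_{ij}` that goes with the Chern connection. -/
def chernB (L a b : E n × E n → ℝ) (p : E n × E n) (k i j : Fin n) : ℝ :=
  ∑ r, (cartanUpUp L p k r i * hilbert L p j + cartanUpUp L p k r j * hilbert L p i
      - cartanUp L p k i j * hilbertUp L p r - cartanUp L p r i j * hilbertUp L p k
      - ∑ s, cartanUp L p k i s * cartanUpUp L p s r j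
      - ∑ s, cartanUp L p k j s * cartanUpUp L p s r i
      + ∑ s, cartanUpUp L p r k s * cartanUp L p s i j) * dLog L a b p r

/-- The tensor `♭B^k_{ij}` that goes with the Berwald connection. The connection forms of the Berwald
connection have no `dy` part, so that `♭D_{\bar j} = ∂/∂y^j` on components. -/
def berwaldB (L a b : E n × E n → ℝ) (p : E n × E n) (k i j : Fin n) : ℝ :=
  ∑ r, (dy j (fun q => cartanUpUp L q k r i) p * L p + cartanUpUp L p k r i * hilbert L p j
      + 2 * cartanUpUp L p r k j * hilbert L p i) * dLog L a b p r

/-- The covariant derivative `D_s P^{ij}` of a twice contravariant tensor density of weight `δ`, at a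
point at which the Christoffel symbols of the connection are `Γ`. -/
def covDeriv (δ : ℝ) (Γ : Fin n → Fin n → Fin n → ℝ) (P : E n → Fin n → Fin n → ℝ) (x : E n)
    (s i j : Fin n) : ℝ :=
  fderiv ℝ (fun z => P z i j) x (e s) + ∑ m, (Γ i s m * P x m j + Γ j s m * P x i m)
    - δ * (∑ t, Γ t t s) * P x i j

/-! ### Geometric objects on a manifold, given by their components in all charts -/

variable {M : Type*} [TopologicalSpace M] [ChartedSpace (E n) M]

/-- The point of `TM` whose coordinates induced by the chart `φ` are `(x, y)`. -/
def lift (φ : OpenPartialHomeomorph M (E n)) (p : E n × E n) : TangentBundle (𝓡 n) M :=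
  tangentMap (𝓡 n) (𝓡 n) φ.symm ⟨p.1, p.2⟩

/-- The coordinate expression in the chart `φ` of a function on `TM`. -/
def local_ (F : TangentBundle (𝓡 n) M → ℝ) (φ : OpenPartialHomeomorph M (E n)) :
    E n × E n → ℝ :=
  fun p => F (lift φ p)

/-- `F : TM → [0, ∞)` is a Finsler structure on `M`. -/
structure IsFinsler [IsManifold (𝓡 n) ∞ M] (F : TangentBundle (𝓡 n) M → ℝ) : Prop where
  nonneg : ∀ v, 0 ≤ F v
  smooth : ContMDiffOn (𝓡 n).tangent 𝓘(ℝ, ℝ) ∞ F {v | v.2 ≠ 0}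
  homogeneous : ∀ (x : M) (y : TangentSpace (𝓡 n) x) (c : ℝ), 0 < c →
    F ⟨x, c • y⟩ = c * F ⟨x, y⟩
  posDef : ∀ φ ∈ IsManifold.maximalAtlas (𝓡 n) ∞ M, ∀ x ∈ φ.target, ∀ y : E n, y ≠ 0 →
    (g (local_ F φ) (x, y)).PosDef

/-- `(M, F)` is a Landsberg space. -/
def IsLandsberg (F : TangentBundle (𝓡 n) M → ℝ) : Prop :=
  ∀ φ ∈ IsManifold.maximalAtlas (𝓡 n) ∞ M, ∀ x ∈ φ.target, ∀ y : E n, y ≠ 0 →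
    ∀ i j k, landsberg (local_ F φ) (x, y) i j k = 0

/-- The Jacobian matrix at `x` of the coordinate change from `φ` to `ψ`. -/
def jacobian (φ ψ : OpenPartialHomeomorph M (E n)) (x : E n) : Matrix (Fin n) (Fin n) ℝ :=
  Matrix.of fun i k => fderiv ℝ (fun z => ψ (φ.symm z)) x (e k) i

/-- `P φ x i j` are the components in the charts `φ` of a smooth symmetric twice contravariant tensor
density of weight `δ` on `M`, a section of `S²TM ⊗ |Λⁿ T^*M|^δ`. -/
structure IsSymTensorDensity (δ : ℝ)
    (P : OpenPartialHomeomorph M (E n) → E n → Fin n → Fin n → ℝ) : Prop where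
  smooth : ∀ φ ∈ IsManifold.maximalAtlas (𝓡 n) ∞ M, ∀ i j,
    ContDiffOn ℝ ∞ (fun x => P φ x i j) φ.target
  symm : ∀ φ ∈ IsManifold.maximalAtlas (𝓡 n) ∞ M, ∀ x ∈ φ.target, ∀ i j, P φ x i j = P φ x j i
  transform : ∀ φ ∈ IsManifold.maximalAtlas (𝓡 n) ∞ M,
    ∀ ψ ∈ IsManifold.maximalAtlas (𝓡 n) ∞ M, ∀ x ∈ φ.target, φ.symm x ∈ ψ.source →
    ∀ i j, P ψ (ψ (φ.symm x)) i j = |(jacobian φ ψ x).det| ^ (-δ) *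
      ∑ k, ∑ l, jacobian φ ψ x i k * jacobian φ ψ x j l * P φ x k l

/-- The pull-back by a diffeomorphism `f` of a geometric object on `M`, `TM` or `TM∖0` given by its
components in all charts: the components of the pulled-back object in the chart `φ` at a point are the
components of the object in the chart `φ ∘ f⁻¹` at the image point. The coordinates of a point with
respect to `φ` are those of its image under `f` (under `Tf`, for tangent vectors) with respect to
`φ ∘ f⁻¹`. -/
def pullback {α : Type*} (f : M ≃ₘ^∞⟮𝓡 n, 𝓡 n⟯ M) (O : OpenPartialHomeomorph M (E n) → α) :
    OpenPartialHomeomorph M (E n) → α :=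
  fun φ => O (f.symm.toHomeomorph.toOpenPartialHomeomorph.trans φ)

/-- The pull-back by `f` of an operator: push the argument forward by `f`, apply the operator, and
pull the result back by `f`. -/
def pullbackOp {α β : Type*} (f : M ≃ₘ^∞⟮𝓡 n, 𝓡 n⟯ M)
    (X : (OpenPartialHomeomorph M (E n) → α) → OpenPartialHomeomorph M (E n) → β) :
    (OpenPartialHomeomorph M (E n) → α) → OpenPartialHomeomorph M (E n) → β :=
  fun P => pullback f (X (pullback f.symm P))

/-- The operator `P ↦ g^{sk} g_{ij} D_s P^{ij}` for the connection with Christoffel symbols `Γ`. -/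
def divOp (F : TangentBundle (𝓡 n) M → ℝ) (δ : ℝ)
    (Γ : OpenPartialHomeomorph M (E n) → E n × E n → Fin n → Fin n → Fin n → ℝ)
    (P : OpenPartialHomeomorph M (E n) → E n → Fin n → Fin n → ℝ) :
    OpenPartialHomeomorph M (E n) → E n × E n → Fin n → ℝ :=
  fun φ p k => ∑ s, ∑ i, ∑ j, gInv (local_ F φ) p s k * g (local_ F φ) p i j *
    covDeriv δ (Γ φ p) (P φ) p.1 s i j

/-- `g^{kl} (Sym_{i,j} g_{sj} B^s_{li} - δ g_{ij} B^t_{lt})`. -/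
def correction (F : TangentBundle (𝓡 n) M → ℝ) (δ : ℝ)
    (B : OpenPartialHomeomorph M (E n) → E n × E n → Fin n → Fin n → Fin n → ℝ) :
    OpenPartialHomeomorph M (E n) → E n × E n → Fin n → Fin n → Fin n → ℝ :=
  fun φ p k i j => ∑ l, gInv (local_ F φ) p k l *
    ((∑ s, (g (local_ F φ) p s j * B φ p s l i + g (local_ F φ) p s i * B φ p s l j))
      - δ * g (local_ F φ) p i j * ∑ t, B φ p t l t)

/-- The operator `𝒜(f)` built from the connection with Christoffel symbols `Γ` and from the tensor `B`:
it sends a symmetric tensor density `P` of weight `δ` on `M` to `𝒜(f)^k_{ij} P^{ij}`, a section of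
`π^*(TM)` with values in the `δ`-densities of `π^*(T^*M)`, in components. `Sym_{i,j}` is the sum over
the two orderings of `i, j`. -/
def cocycleOp (F : TangentBundle (𝓡 n) M → ℝ) (δ : ℝ)
    (Γ B : OpenPartialHomeomorph M (E n) → E n × E n → Fin n → Fin n → Fin n → ℝ)
    (f : M ≃ₘ^∞⟮𝓡 n, 𝓡 n⟯ M)
    (P : OpenPartialHomeomorph M (E n) → E n → Fin n → Fin n → ℝ) :
    OpenPartialHomeomorph M (E n) → E n × E n → Fin n → ℝ :=
  fun φ p k =>
    let ℓ := fun k i j => pullback f Γ φ p k i j - Γ φ p k i j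
    let ΔB := fun k i j => pullback f B φ p k i j - B φ p k i j
    pullbackOp f (divOp F δ Γ) P φ p k - divOp F δ Γ P φ p k
      + ∑ i, ∑ j,
        ((2 - δ * n) * (ℓ k i j
            - (1 / n : ℝ) * (kron i k * ∑ t, ℓ t t j + kron j k * ∑ t, ℓ t t i))
          + (correction F δ B φ p k i j - pullback f (correction F δ B) φ p k i j)
          - (2 - δ * n) * (ΔB k i j
            - (1 / n : ℝ) * (kron i k * ∑ t, ΔB t j t + kron j k * ∑ t, ΔB t i t)))
        * P φ p.1 i j

/-- The operator `𝒜(f)`, built from the Chern connection; the functions `a`, `b` on `TM` determine the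
bundle map `u = a h + b v`. -/
def chernOp (F a b : TangentBundle (𝓡 n) M → ℝ) (δ : ℝ) (f : M ≃ₘ^∞⟮𝓡 n, 𝓡 n⟯ M)
    (P : OpenPartialHomeomorph M (E n) → E n → Fin n → Fin n → ℝ) :
    OpenPartialHomeomorph M (E n) → E n × E n → Fin n → ℝ :=
  cocycleOp F δ (fun φ => chern (local_ F φ))
    (fun φ => chernB (local_ F φ) (local_ a φ) (local_ b φ)) f P

/-- The operator `♭𝒜(f)`, built from the Berwald connection. -/
def berwaldOp (F a b : TangentBundle (𝓡 n) M → ℝ) (δ : ℝ) (f : M ≃ₘ^∞⟮𝓡 n, 𝓡 n⟯ M)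
    (P : OpenPartialHomeomorph M (E n) → E n → Fin n → Fin n → ℝ) :
    OpenPartialHomeomorph M (E n) → E n × E n → Fin n → ℝ :=
  cocycleOp F δ (fun φ => berwald (local_ F φ))
    (fun φ => berwaldB (local_ F φ) (local_ a φ) (local_ b φ)) f P

end Finsler

end

/-!
Everything is local. In a chart put `E = L²/2`, so that `g_{ij} = ∂²E/∂y^i∂y^j`, and let
`δ_r = ∂/∂x^r - N^m_r ∂/∂y^m`. Contracting the spray with `y` and using Euler's relations gives
`S^k ∂E/∂y^k = 2 y^j ∂E/∂x^j`, and differentiating this along the fibre gives `δ_r E = 0`, hence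
`δ_r L = 0`.

Since `[∂/∂y^j, δ_r] = -♭γ^m_{rj} ∂/∂y^m`, applying `∂/∂y^j` and then `∂/∂y^i` to `δ_r E = 0`
yields `δ_r g_{ij} = g_{im} ♭γ^m_{rj} + g_{jm} ♭γ^m_{ri} - 2 Ȧ_{rij}`. The Chern symbols are the
Christoffel symbols of `g` formed with `δ` in place of `∂/∂x`, so Koszul's trick turns this into
`γ^k_{ij} = ♭γ^k_{ij} - g^{ks} Ȧ_{sij}`, and the two connections agree on a Landsberg space.

From `δ_r L = 0` we also get `d_r (log L) = (b/L) ω_r`. As `A` vanishes when contracted with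
`ω`, both `B^k_{ij}` and `♭B^k_{ij}` reduce to `-(b/L) A^k_{ij}`. Finally, at a point `𝒜(f)`
only involves the components of the connection and of `B` there, in the charts `φ` and
`φ ∘ f⁻¹`.
-/

namespace Finsler

variable {n : ℕ}

section Calculus

variable {V X Y : Type*} [NormedAddCommGroup V] [NormedSpace ℝ V] [NormedAddCommGroup X]
  [NormedSpace ℝ X] [NormedAddCommGroup Y] [NormedSpace ℝ Y]

theorem fderiv_fderiv_apply {h : V → ℝ} {p : V} (hh : ContDiffAt ℝ 2 h p) (v w : V) :
    fderiv ℝ (fun q => fderiv ℝ h q w) p v = fderiv ℝ (fderiv ℝ h) p v w := by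
  have hd : DifferentiableAt ℝ (fderiv ℝ h) p :=
    (hh.fderiv_right (m := 1) (by norm_num)).differentiableAt (by simp)
  simp [fderiv_clm_apply hd (differentiableAt_const w)]

theorem fderiv_fderiv_apply_comm {h : V → ℝ} {p : V} (hh : ContDiffAt ℝ 2 h p) (v w : V) :
    fderiv ℝ (fun q => fderiv ℝ h q w) p v = fderiv ℝ (fun q => fderiv ℝ h q v) p w := by
  rw [fderiv_fderiv_apply hh, fderiv_fderiv_apply hh]
  exact hh.isSymmSndFDerivAt (by simp) v w

theorem fderiv_vertical_of_homogeneous {h : X × Y → ℝ} {p : X × Y} (hd : DifferentiableAt ℝ h p)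
    {k : ℕ} (hh : ∀ c : ℝ, 0 < c → h (p.1, c • p.2) = c ^ k * h p) :
    fderiv ℝ h p (0, p.2) = k * h p := by
  have hray : HasDerivAt (fun c : ℝ => (p.1, c • p.2)) (0, p.2) 1 := by
    simpa using (hasDerivAt_const (1 : ℝ) p.1).prodMk ((hasDerivAt_id (1 : ℝ)).smul_const p.2)
  have hchain : HasDerivAt (fun c : ℝ => h (p.1, c • p.2)) (fderiv ℝ h p (0, p.2)) 1 :=
    HasFDerivAt.comp_hasDerivAt (1 : ℝ) (by simpa using hd.hasFDerivAt) hray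
  have hpow : HasDerivAt (fun c : ℝ => c ^ k * h p) (k * h p) 1 := by
    simpa using (hasDerivAt_pow k (1 : ℝ)).mul_const (h p)
  refine hchain.unique (hpow.congr_of_eventuallyEq ?_)
  filter_upwards [lt_mem_nhds one_pos] with c hc using hh c hc

theorem fderiv_fderiv_apply_vertical {h : X × Y → ℝ} {p : X × Y} (hh : ContDiffAt ℝ 2 h p) {c : ℝ}
    (he : (fun q => fderiv ℝ h q (0, q.2)) =ᶠ[nhds p] fun q => c * h q) (v : X × Y) :
    fderiv ℝ (fun q => fderiv ℝ h q v) p (0, p.2)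
      = c * fderiv ℝ h p v - fderiv ℝ h p (0, v.2) := by
  have hd : DifferentiableAt ℝ (fderiv ℝ h) p :=
    (hh.fderiv_right (m := 1) (by norm_num)).differentiableAt (by simp)
  have hvert : HasFDerivAt (fun q : X × Y => ((0 : X), q.2))
      ((0 : X × Y →L[ℝ] X).prod (ContinuousLinearMap.snd ℝ X Y)) p :=
    (hasFDerivAt_const (0 : X) p).prodMk hasFDerivAt_snd
  have key := DFunLike.congr_fun (he.fderiv_eq (𝕜 := ℝ)) v
  rw [fderiv_clm_apply hd hvert.differentiableAt, hvert.fderiv,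
    fderiv_const_mul (hh.differentiableAt (by simp))] at key
  simp only [add_apply, ContinuousLinearMap.comp_apply, ContinuousLinearMap.flip_apply,
    ContinuousLinearMap.prod_apply, zero_apply, ContinuousLinearMap.coe_snd',
    smul_apply, smul_eq_mul] at key
  rw [fderiv_fderiv_apply_comm hh, fderiv_fderiv_apply hh, ← key, add_sub_cancel_left]

theorem contDiffAt_matrix_det {m : Type*} [Fintype m] [DecidableEq m] {r : WithTop ℕ∞}
    {A : V → Matrix m m ℝ} {p : V} (hA : ∀ i j, ContDiffAt ℝ r (fun q => A q i j) p) :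
    ContDiffAt ℝ r (fun q => (A q).det) p := by
  simp only [Matrix.det_apply']
  exact ContDiffAt.sum fun σ _ => contDiffAt_const.mul (contDiffAt_prod fun i _ => hA _ _)

theorem contDiffAt_matrix_inv_apply {m : Type*} [Fintype m] [DecidableEq m] {r : WithTop ℕ∞}
    {A : V → Matrix m m ℝ} {p : V} (hA : ∀ i j, ContDiffAt ℝ r (fun q => A q i j) p)
    (hdet : (A p).det ≠ 0) (i j : m) : ContDiffAt ℝ r (fun q => (A q)⁻¹ i j) p := by
  have cramer : (fun q => (A q)⁻¹ i j) =
      fun q => (A q).det⁻¹ * ((A q).updateRow j (Pi.single i 1)).det := by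
    funext q
    simp [Matrix.inv_def, Matrix.adjugate_apply]
  rw [cramer]
  refine ((contDiffAt_matrix_det hA).inv hdet).mul (contDiffAt_matrix_det fun s t => ?_)
  by_cases hs : s = j
  · simpa [hs] using contDiffAt_const
  · simpa [hs] using hA s t

end Calculus

section Partial

variable {h k : E n × E n → ℝ} {p : E n × E n}

theorem contDiffAt_dx (hh : ContDiffAt ℝ ∞ h p) (i : Fin n) : ContDiffAt ℝ ∞ (dx i h) p :=
  (hh.fderiv_right (by simp)).clm_apply contDiffAt_const

theorem contDiffAt_dy (hh : ContDiffAt ℝ ∞ h p) (i : Fin n) : ContDiffAt ℝ ∞ (dy i h) p :=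
  (hh.fderiv_right (by simp)).clm_apply contDiffAt_const

theorem dx_congr (hk : h =ᶠ[nhds p] k) (i : Fin n) : dx i h p = dx i k p := by
  rw [dx, dx, hk.fderiv_eq]

theorem dy_congr (hk : h =ᶠ[nhds p] k) (i : Fin n) : dy i h p = dy i k p := by
  rw [dy, dy, hk.fderiv_eq]

theorem dy_dy_comm (hh : ContDiffAt ℝ 2 h p) (i j : Fin n) :
    dy i (dy j h) p = dy j (dy i h) p :=
  fderiv_fderiv_apply_comm hh _ _

theorem dy_dx_comm (hh : ContDiffAt ℝ 2 h p) (i j : Fin n) :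
    dy i (dx j h) p = dx j (dy i h) p :=
  fderiv_fderiv_apply_comm hh _ _

theorem dy_const_mul (c : ℝ) (i : Fin n) : dy i (fun q => c * h q) = fun q => c * dy i h q := by
  funext q
  exact congrArg (fun θ : E n × E n → E n × E n →L[ℝ] ℝ => θ q (0, e i))
    (fderiv_const_smul_field (f := h) c)

theorem dy_const (c : ℝ) (i : Fin n) : dy i (fun _ : E n × E n => c) p = 0 := by
  simp [dy]

theorem dy_mul (hh : DifferentiableAt ℝ h p) (hk : DifferentiableAt ℝ k p) (i : Fin n) :
    dy i (fun q => h q * k q) p = dy i h p * k p + h p * dy i k p := by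
  simp only [dy, fderiv_fun_mul hh hk, add_apply, smul_apply, smul_eq_mul]
  ring

theorem dy_sub (hh : DifferentiableAt ℝ h p) (hk : DifferentiableAt ℝ k p) (i : Fin n) :
    dy i (fun q => h q - k q) p = dy i h p - dy i k p := by
  simp [dy, fderiv_fun_sub hh hk]

theorem dy_sum_mul {ι : Type*} {s : Finset ι} {H K : ι → E n × E n → ℝ}
    (hH : ∀ a, DifferentiableAt ℝ (H a) p) (hK : ∀ a, DifferentiableAt ℝ (K a) p) (i : Fin n) :
    dy i (fun q => ∑ a ∈ s, H a q * K a q) p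
      = ∑ a ∈ s, dy i (H a) p * K a p + ∑ a ∈ s, H a p * dy i (K a) p := by
  rw [← Finset.sum_add_distrib, dy, fderiv_fun_sum fun a _ => (hH a).fun_mul (hK a), sum_apply]
  exact Finset.sum_congr rfl fun a _ => dy_mul (hH a) (hK a) i

theorem dy_snd_apply (i j : Fin n) :
    dy i (fun q : E n × E n => q.2 j) p = if i = j then 1 else 0 := by
  have hcoord : HasFDerivAt (fun q : E n × E n => q.2 j)
      ((EuclideanSpace.proj j : E n →L[ℝ] ℝ).comp (ContinuousLinearMap.snd ℝ (E n) (E n))) p :=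
    ((EuclideanSpace.proj j : E n →L[ℝ] ℝ).comp
      (ContinuousLinearMap.snd ℝ (E n) (E n))).hasFDerivAt
  simp [dy, hcoord.fderiv, e, eq_comm]

theorem dy_sum_mul_snd {H : Fin n → E n × E n → ℝ} (hH : ∀ m, DifferentiableAt ℝ (H m) p)
    (r : Fin n) :
    dy r (fun q => ∑ m, H m q * q.2 m) p = ∑ m, dy r (H m) p * p.2 m + H r p := by
  rw [dy_sum_mul hH fun m => by fun_prop]
  simp [dy_snd_apply]

theorem fderiv_vertical (v : E n) : fderiv ℝ h p (0, v) = ∑ m, dy m h p * v m := by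
  have hv : ((0 : E n), v) = ∑ m, v m • ((0 : E n), e m) := by
    have hbasis : ∑ m, v m • e m = v := by
      simpa [e] using (EuclideanSpace.basisFun (Fin n) ℝ).sum_repr v
    ext1 <;> simp [Prod.fst_sum, Prod.snd_sum, hbasis]
  simp only [hv, map_sum, map_smul, smul_eq_mul, dy, mul_comm]

/-- The Liouville vector field `y^m ∂/∂y^m`, whose eigenfunctions are, by Euler, the functions that
are homogeneous on the fibres of `TM`. -/
noncomputable def radial (h : E n × E n → ℝ) (p : E n × E n) : ℝ := ∑ m, dy m h p * p.2 m

theorem radial_eq_fderiv (h : E n × E n → ℝ) : radial h = fun p => fderiv ℝ h p (0, p.2) :=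
  funext fun p => (fderiv_vertical p.2).symm

theorem radial_dx (hh : ContDiffAt ℝ 2 h p) {c : ℝ}
    (he : radial h =ᶠ[nhds p] fun q => c * h q) (i : Fin n) :
    radial (dx i h) p = c * dx i h p := by
  rw [radial_eq_fderiv] at he ⊢
  have key := fderiv_fderiv_apply_vertical hh he (e i, 0)
  rwa [Prod.mk_zero_zero, map_zero, sub_zero] at key

theorem radial_dy (hh : ContDiffAt ℝ 2 h p) {c : ℝ}
    (he : radial h =ᶠ[nhds p] fun q => c * h q) (i : Fin n) :
    radial (dy i h) p = (c - 1) * dy i h p := by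
  rw [radial_eq_fderiv] at he ⊢
  rw [sub_one_mul]
  exact fderiv_fderiv_apply_vertical hh he (0, e i)

end Partial

/-- The energy `L²/2`, whose fibre Hessian is the fundamental tensor. -/
noncomputable def energy (L : E n × E n → ℝ) (p : E n × E n) : ℝ := (1 / 2 : ℝ) * L p ^ 2

/-- The spray coefficients `g^{ks} (∂g_{si}/∂x^j + ∂g_{sj}/∂x^i - ∂g_{ij}/∂x^s) y^i y^j`, of which
the nonlinear connection is a quarter of the fibre derivative. -/
noncomputable def spray (L : E n × E n → ℝ) (k : Fin n) (p : E n × E n) : ℝ :=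
  ∑ s, ∑ i, ∑ j, gInv L p k s * firstKind L p s i j * p.2 j * p.2 i

/-- The horizontal derivative `δ/δx^r = ∂/∂x^r - N^m_r ∂/∂y^m`. -/
noncomputable def horizontal (L : E n × E n → ℝ) (r : Fin n) (h : E n × E n → ℝ) (p : E n × E n) :
    ℝ :=
  dx r h p - ∑ m, nonlin L p m r * dy m h p

/-- The coordinate domain of `TM∖0` over the subset `U` of a chart. -/
def slit (U : Set (E n)) : Set (E n × E n) := U ×ˢ {0}ᶜ

/-- `L` is the coordinate expression of a Finsler structure over the subset `U` of a chart. -/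
structure IsLocalFinsler (U : Set (E n)) (L : E n × E n → ℝ) : Prop where
  isOpen : IsOpen U
  smooth : ContDiffOn ℝ ∞ L (slit U)
  homogeneous : ∀ p ∈ slit U, ∀ c : ℝ, 0 < c → L (p.1, c • p.2) = c * L p
  posDef : ∀ p ∈ slit U, (g L p).PosDef

section Coordinates

variable {L h k : E n × E n → ℝ} {p : E n × E n}

theorem g_eq_dy_dy_energy (i j : Fin n) : (fun q => g L q i j) = dy i (dy j (energy L)) := by
  have henergy : dy j (energy L) = fun q => (1 / 2 : ℝ) * dy j (fun q => L q ^ 2) q :=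
    dy_const_mul _ _
  rw [henergy, dy_const_mul]
  rfl

theorem g_apply (p : E n × E n) (i j : Fin n) : g L p i j = dy i (dy j (energy L)) p :=
  congrFun (g_eq_dy_dy_energy i j) p

theorem nonlin_eq_dy_spray (p : E n × E n) (k m : Fin n) :
    nonlin L p k m = (1 / 4 : ℝ) * dy m (spray L k) p := rfl

theorem spray_eq_sum_gInv_mul (p : E n × E n) (k : Fin n) :
    spray L k p = ∑ s, gInv L p k s * ∑ i, ∑ j, firstKind L p s i j * p.2 j * p.2 i := by
  simp only [spray, Finset.mul_sum, mul_assoc]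

theorem horizontal_of_fderiv_eq_smul {c : ℝ} (hc : fderiv ℝ h p = c • fderiv ℝ k p) (r : Fin n) :
    horizontal L r h p = c * horizontal L r k p := by
  simp only [horizontal, dx, dy, hc, smul_apply, smul_eq_mul, mul_sub, Finset.mul_sum,
    mul_left_comm c]

theorem cartanUpUp_eq_sum_cartanUp (p : E n × E n) (k r i : Fin n) :
    cartanUpUp L p k r i = ∑ a, cartanUp L p r i a * gInv L p a k := by
  simp only [cartanUpUp, cartanUp, Finset.sum_mul, mul_right_comm]

end Coordinates

namespace IsLocalFinsler

variable {U : Set (E n)} {L : E n × E n → ℝ} {p : E n × E n}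

theorem slit_mem_nhds (hL : IsLocalFinsler U L) (hp : p ∈ slit U) : slit U ∈ nhds p :=
  (hL.isOpen.prod isOpen_compl_singleton).mem_nhds hp

theorem eventuallyEq (hL : IsLocalFinsler U L) (hp : p ∈ slit U) {h k : E n × E n → ℝ}
    (hk : ∀ q ∈ slit U, h q = k q) : h =ᶠ[nhds p] k :=
  Filter.eventuallyEq_of_mem (hL.slit_mem_nhds hp) hk

section Smoothness

theorem contDiffAt (hL : IsLocalFinsler U L) (hp : p ∈ slit U) : ContDiffAt ℝ ∞ L p :=
  hL.smooth.contDiffAt (hL.slit_mem_nhds hp)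

theorem contDiffAt_energy (hL : IsLocalFinsler U L) (hp : p ∈ slit U) :
    ContDiffAt ℝ ∞ (energy L) p :=
  contDiffAt_const.mul ((hL.contDiffAt hp).pow 2)

theorem contDiffAt_g (hL : IsLocalFinsler U L) (hp : p ∈ slit U) (i j : Fin n) :
    ContDiffAt ℝ ∞ (fun q => g L q i j) p := by
  rw [g_eq_dy_dy_energy]
  exact contDiffAt_dy (contDiffAt_dy (hL.contDiffAt_energy hp) j) i

theorem det_g_ne_zero (hL : IsLocalFinsler U L) (hp : p ∈ slit U) : (g L p).det ≠ 0 :=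
  (hL.posDef p hp).det_pos.ne'

theorem contDiffAt_gInv (hL : IsLocalFinsler U L) (hp : p ∈ slit U) (i j : Fin n) :
    ContDiffAt ℝ ∞ (fun q => gInv L q i j) p :=
  contDiffAt_matrix_inv_apply (hL.contDiffAt_g hp) (hL.det_g_ne_zero hp) i j

theorem contDiffAt_firstKind (hL : IsLocalFinsler U L) (hp : p ∈ slit U) (s i j : Fin n) :
    ContDiffAt ℝ ∞ (fun q => firstKind L q s i j) p :=
  ((contDiffAt_dx (hL.contDiffAt_g hp s i) j).add (contDiffAt_dx (hL.contDiffAt_g hp s j) i)).sub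
    (contDiffAt_dx (hL.contDiffAt_g hp i j) s)

theorem contDiffAt_spray (hL : IsLocalFinsler U L) (hp : p ∈ slit U) (k : Fin n) :
    ContDiffAt ℝ ∞ (spray L k) p :=
  ContDiffAt.sum fun s _ => ContDiffAt.sum fun i _ => ContDiffAt.sum fun j _ =>
    (((hL.contDiffAt_gInv hp k s).mul (hL.contDiffAt_firstKind hp s i j)).mul (by fun_prop)).mul
      (by fun_prop)

theorem contDiffAt_nonlin (hL : IsLocalFinsler U L) (hp : p ∈ slit U) (k m : Fin n) :
    ContDiffAt ℝ ∞ (fun q => nonlin L q k m) p :=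
  contDiffAt_const.mul (contDiffAt_dy (hL.contDiffAt_spray hp k) m)

theorem contDiffAt_berwald (hL : IsLocalFinsler U L) (hp : p ∈ slit U) (k i j : Fin n) :
    ContDiffAt ℝ ∞ (fun q => berwald L q k i j) p :=
  contDiffAt_dy (hL.contDiffAt_nonlin hp k i) j

theorem contDiffAt_cartanUpUp (hL : IsLocalFinsler U L) (hp : p ∈ slit U) (k r i : Fin n) :
    ContDiffAt ℝ ∞ (fun q => cartanUpUp L q k r i) p :=
  ContDiffAt.sum fun a _ => ContDiffAt.sum fun b _ =>
    ((((hL.contDiffAt hp).div_const 2).mul (contDiffAt_dy (hL.contDiffAt_g hp i a) b)).mul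
      (hL.contDiffAt_gInv hp a k)).mul (hL.contDiffAt_gInv hp b r)

end Smoothness

section FundamentalTensor

theorem g_symm (hL : IsLocalFinsler U L) (hp : p ∈ slit U) (i j : Fin n) :
    g L p i j = g L p j i := by
  rw [g_apply, g_apply, dy_dy_comm ((hL.contDiffAt_energy hp).of_le (by norm_cast))]

theorem sum_gInv_mul_sum_g (hL : IsLocalFinsler U L) (hp : p ∈ slit U) (v : Fin n → ℝ)
    (k : Fin n) : ∑ s, gInv L p k s * ∑ m, g L p s m * v m = v k := by
  have key := congrFun (Matrix.mulVec_mulVec v (g L p)⁻¹ (g L p)) k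
  rwa [Matrix.nonsing_inv_mul _ (hL.det_g_ne_zero hp).isUnit, Matrix.one_mulVec] at key

theorem sum_g_mul_sum_gInv (hL : IsLocalFinsler U L) (hp : p ∈ slit U) (v : Fin n → ℝ)
    (k : Fin n) : ∑ s, g L p k s * ∑ m, gInv L p s m * v m = v k := by
  have key := congrFun (Matrix.mulVec_mulVec v (g L p) (g L p)⁻¹) k
  rwa [Matrix.mul_nonsing_inv _ (hL.det_g_ne_zero hp).isUnit, Matrix.one_mulVec] at key

theorem sum_sum_gInv_mul_g (hL : IsLocalFinsler U L) (hp : p ∈ slit U) (v : Fin n → ℝ)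
    (k : Fin n) : ∑ s, (∑ m, v m * gInv L p m s) * g L p s k = v k := by
  have key := congrFun (Matrix.vecMul_vecMul v (g L p)⁻¹ (g L p)) k
  rwa [Matrix.nonsing_inv_mul _ (hL.det_g_ne_zero hp).isUnit, Matrix.vecMul_one] at key

end FundamentalTensor

section Homogeneity

theorem radial_energy (hL : IsLocalFinsler U L) (hp : p ∈ slit U) :
    radial (energy L) p = 2 * energy L p := by
  rw [radial_eq_fderiv]
  refine fderiv_vertical_of_homogeneous ((hL.contDiffAt_energy hp).differentiableAt (by simp))
    (k := 2) fun c hc => ?_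
  rw [energy, hL.homogeneous p hp c hc, energy]
  ring

theorem radial_dx_energy (hL : IsLocalFinsler U L) (hp : p ∈ slit U) (i : Fin n) :
    radial (dx i (energy L)) p = 2 * dx i (energy L) p :=
  radial_dx ((hL.contDiffAt_energy hp).of_le (by norm_cast))
    (hL.eventuallyEq hp fun _ => hL.radial_energy) i

theorem radial_dy_energy (hL : IsLocalFinsler U L) (hp : p ∈ slit U) (i : Fin n) :
    radial (dy i (energy L)) p = dy i (energy L) p := by
  rw [radial_dy ((hL.contDiffAt_energy hp).of_le (by norm_cast))
    (hL.eventuallyEq hp fun _ => hL.radial_energy) i]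
  norm_num

theorem radial_dx_dy_energy (hL : IsLocalFinsler U L) (hp : p ∈ slit U) (i j : Fin n) :
    radial (dx i (dy j (energy L))) p = dx i (dy j (energy L)) p := by
  rw [radial_dx (c := 1) ((contDiffAt_dy (hL.contDiffAt_energy hp) j).of_le (by norm_cast))
    (hL.eventuallyEq hp fun _ hq => (hL.radial_dy_energy hq j).trans (one_mul _).symm), one_mul]

theorem radial_dy_dy_energy (hL : IsLocalFinsler U L) (hp : p ∈ slit U) (i j : Fin n) :
    radial (dy i (dy j (energy L))) p = 0 := by
  rw [radial_dy (c := 1) ((contDiffAt_dy (hL.contDiffAt_energy hp) j).of_le (by norm_cast))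
    (hL.eventuallyEq hp fun _ hq => (hL.radial_dy_energy hq j).trans (one_mul _).symm), sub_self,
    zero_mul]

theorem sum_g_mul_snd (hL : IsLocalFinsler U L) (hp : p ∈ slit U) (i : Fin n) :
    ∑ m, g L p i m * p.2 m = dy i (energy L) p := by
  rw [← hL.radial_dy_energy hp i, radial]
  exact Finset.sum_congr rfl fun m _ => by rw [hL.g_symm hp, g_apply]

theorem radial_g (hL : IsLocalFinsler U L) (hp : p ∈ slit U) (i j : Fin n) :
    radial (fun q => g L q i j) p = 0 := by
  rw [g_eq_dy_dy_energy, hL.radial_dy_dy_energy hp]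

theorem sum_dx_g_mul_snd (hL : IsLocalFinsler U L) (hp : p ∈ slit U) (i k : Fin n) :
    ∑ m, dx k (fun q => g L q i m) p * p.2 m = dx k (dy i (energy L)) p := by
  rw [← hL.radial_dx_dy_energy hp k i, radial]
  refine Finset.sum_congr rfl fun m _ => ?_
  rw [dx_congr (hL.eventuallyEq hp fun _ hq => hL.g_symm hq i m), g_eq_dy_dy_energy,
    dy_dx_comm ((contDiffAt_dy (hL.contDiffAt_energy hp) i).of_le (by norm_cast))]

theorem sum_dx_dy_energy_mul_snd (hL : IsLocalFinsler U L) (hp : p ∈ slit U) (k : Fin n) :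
    ∑ m, dx k (dy m (energy L)) p * p.2 m = 2 * dx k (energy L) p := by
  rw [← hL.radial_dx_energy hp k, radial]
  simp only [dy_dx_comm ((hL.contDiffAt_energy hp).of_le (by norm_cast))]

theorem ne_zero (hL : IsLocalFinsler U L) (hp : p ∈ slit U) : L p ≠ 0 := by
  have hy : (p.2 : Fin n → ℝ) ≠ 0 := fun h => hp.2 (by ext i; exact congrFun h i)
  have hpos := (hL.posDef p hp).dotProduct_mulVec_pos hy
  have hval : star (p.2 : Fin n → ℝ) ⬝ᵥ (g L p).mulVec p.2 = L p ^ 2 := by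
    have hE : ∑ m, dy m (energy L) p * p.2 m = 2 * energy L p := hL.radial_energy hp
    simp only [dotProduct, Matrix.mulVec, hL.sum_g_mul_snd hp, Pi.star_apply, star_trivial]
    simp only [mul_comm (p.2 _), hE, energy]
    ring
  rw [hval] at hpos
  exact (pow_ne_zero_iff two_ne_zero).1 hpos.ne'

end Homogeneity

section HilbertForm

theorem fderiv_energy (hL : IsLocalFinsler U L) (hp : p ∈ slit U) :
    fderiv ℝ (energy L) p = L p • fderiv ℝ L p := by
  have hd := (hL.contDiffAt hp).differentiableAt (by simp)
  unfold energy
  rw [fderiv_const_mul (hd.fun_pow 2), fderiv_fun_pow 2 hd, smul_smul]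
  congr 1
  simp

theorem dy_energy (hL : IsLocalFinsler U L) (hp : p ∈ slit U) (i : Fin n) :
    dy i (energy L) p = L p * hilbert L p i := by
  rw [dy, hL.fderiv_energy hp]
  rfl

theorem hilbertUp_eq (hL : IsLocalFinsler U L) (hp : p ∈ slit U) (k : Fin n) :
    hilbertUp L p k = p.2 k / L p := by
  rw [eq_div_iff (hL.ne_zero hp), ← hL.sum_gInv_mul_sum_g hp (fun m => p.2 m) k, hilbertUp,
    Finset.sum_mul]
  refine Finset.sum_congr rfl fun s _ => ?_
  rw [hL.sum_g_mul_snd hp, hL.dy_energy hp, mul_assoc, mul_comm (L p)]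

theorem sum_hilbertUp_mul_hilbert (hL : IsLocalFinsler U L) (hp : p ∈ slit U) :
    ∑ r, hilbertUp L p r * hilbert L p r = 1 := by
  have hL0 := hL.ne_zero hp
  have hE : ∑ r, dy r (energy L) p * p.2 r = L p ^ 2 := by
    rw [← radial, hL.radial_energy hp, energy]
    ring
  calc ∑ r, hilbertUp L p r * hilbert L p r
      = (∑ r, dy r (energy L) p * p.2 r) / L p ^ 2 := by
        rw [Finset.sum_div]
        refine Finset.sum_congr rfl fun r _ => ?_
        rw [hL.hilbertUp_eq hp, hL.dy_energy hp]
        field_simp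
    _ = 1 := by rw [hE, div_self (pow_ne_zero 2 hL0)]

theorem mul_dy_hilbert (hL : IsLocalFinsler U L) (hp : p ∈ slit U) (j r : Fin n) :
    L p * dy j (fun q => hilbert L q r) p = g L p r j - hilbert L p j * hilbert L p r := by
  have hd := (hL.contDiffAt hp).differentiableAt (by simp)
  have hdh := (contDiffAt_dy (hL.contDiffAt hp) r).differentiableAt (by simp)
  have hg : g L p j r = hilbert L p j * hilbert L p r + L p * dy j (fun q => hilbert L q r) p := by
    rw [g_apply, dy_congr (hL.eventuallyEq hp fun _ hq => hL.dy_energy hq r)]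
    exact dy_mul hd hdh j
  rw [hL.g_symm hp, hg, add_sub_cancel_left]

end HilbertForm

section CartanTensor

theorem cartan_symm (hL : IsLocalFinsler U L) (hp : p ∈ slit U) (i j k : Fin n) :
    cartan L p i j k = cartan L p j i k := by
  rw [cartan, cartan, dy_congr (hL.eventuallyEq hp fun _ hq => hL.g_symm hq i j)]

theorem cartan_swap (hL : IsLocalFinsler U L) (hp : p ∈ slit U) (i j k : Fin n) :
    cartan L p i j k = cartan L p k j i := by
  simp only [cartan, g_eq_dy_dy_energy,
    dy_dy_comm ((contDiffAt_dy (hL.contDiffAt_energy hp) j).of_le (by norm_cast)) k i]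

theorem sum_cartan_mul_hilbertUp (hL : IsLocalFinsler U L) (hp : p ∈ slit U) (i j : Fin n) :
    ∑ m, cartan L p i j m * hilbertUp L p m = 0 := by
  have hL0 := hL.ne_zero hp
  calc ∑ m, cartan L p i j m * hilbertUp L p m
      = (1 / 2 : ℝ) * radial (fun q => g L q i j) p := by
        rw [radial, Finset.mul_sum]
        refine Finset.sum_congr rfl fun m _ => ?_
        rw [hL.hilbertUp_eq hp, cartan]
        field_simp
    _ = 0 := by rw [hL.radial_g hp, mul_zero]

theorem sum_cartanUp_mul_hilbert (hL : IsLocalFinsler U L) (hp : p ∈ slit U) (i j : Fin n) :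
    ∑ r, cartanUp L p r i j * hilbert L p r = 0 := by
  rw [← hL.sum_cartan_mul_hilbertUp hp i j]
  simp only [cartanUp, hilbertUp, Finset.sum_mul, Finset.mul_sum]
  rw [Finset.sum_comm]
  simp only [mul_assoc]

theorem sum_cartanUpUp_mul_hilbert (hL : IsLocalFinsler U L) (hp : p ∈ slit U) (k i : Fin n) :
    ∑ r, cartanUpUp L p k r i * hilbert L p r = 0 := by
  simp only [cartanUpUp_eq_sum_cartanUp, Finset.sum_mul]
  rw [Finset.sum_comm]
  refine Finset.sum_eq_zero fun a _ => ?_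
  rw [← zero_mul (gInv L p a k), ← hL.sum_cartanUp_mul_hilbert hp i a, Finset.sum_mul]
  exact Finset.sum_congr rfl fun r _ => mul_right_comm _ _ _

theorem cartanUpUp_symm (hL : IsLocalFinsler U L) (hp : p ∈ slit U) (k r i : Fin n) :
    cartanUpUp L p k r i = cartanUpUp L p r k i := by
  have hA : ∀ a b, cartan L p i a b = cartan L p i b a := fun a b => by
    rw [hL.cartan_symm hp, hL.cartan_swap hp, hL.cartan_symm hp]
  simp only [cartanUpUp]
  rw [Finset.sum_comm]
  exact Finset.sum_congr rfl fun b _ => Finset.sum_congr rfl fun a _ => by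
    rw [hA, mul_right_comm]

theorem sum_cartanUpUp_mul_g (hL : IsLocalFinsler U L) (hp : p ∈ slit U) (k i j : Fin n) :
    ∑ r, cartanUpUp L p k r i * g L p r j = cartanUp L p k i j := by
  simp only [hL.cartanUpUp_symm hp k, cartanUpUp_eq_sum_cartanUp]
  exact hL.sum_sum_gInv_mul_g hp (cartanUp L p k i) j

theorem mul_sum_dy_cartanUpUp_mul_hilbert (hL : IsLocalFinsler U L) (hp : p ∈ slit U)
    (k i j : Fin n) :
    L p * ∑ r, dy j (fun q => cartanUpUp L q k r i) p * hilbert L p r = -cartanUp L p k i j := by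
  have hdA : ∀ r, DifferentiableAt ℝ (fun q => cartanUpUp L q k r i) p := fun r =>
    (hL.contDiffAt_cartanUpUp hp k r i).differentiableAt (by simp)
  have hdω : ∀ r, DifferentiableAt ℝ (fun q => hilbert L q r) p := fun r =>
    (contDiffAt_dy (hL.contDiffAt hp) r).differentiableAt (by simp)
  have key := dy_congr (hL.eventuallyEq hp fun _ hq => hL.sum_cartanUpUp_mul_hilbert hq k i) j
  rw [dy_const, dy_sum_mul hdA hdω] at key
  have hω : L p * ∑ r, cartanUpUp L p k r i * dy j (fun q => hilbert L q r) p
      = cartanUp L p k i j := by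
    simp only [Finset.mul_sum, mul_left_comm (L p), hL.mul_dy_hilbert hp, mul_sub,
      Finset.sum_sub_distrib, mul_left_comm _ (hilbert L p j)]
    rw [← Finset.mul_sum, hL.sum_cartanUpUp_mul_g hp, hL.sum_cartanUpUp_mul_hilbert hp, mul_zero,
      sub_zero]
  rw [eq_neg_of_add_eq_zero_left key, mul_neg, hω]

end CartanTensor

section Spray

theorem sum_firstKind (hL : IsLocalFinsler U L) (hp : p ∈ slit U) (s : Fin n) :
    ∑ i, ∑ j, firstKind L p s i j * p.2 j * p.2 i
      = 2 * (∑ j, dx j (dy s (energy L)) p * p.2 j - dx s (energy L) p) := by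
  have hj : ∑ i, ∑ j, dx j (fun q => g L q s i) p * p.2 j * p.2 i
      = ∑ j, dx j (dy s (energy L)) p * p.2 j := by
    simp only [← hL.sum_dx_g_mul_snd hp, Finset.sum_mul]
    rw [Finset.sum_comm]
    simp only [mul_right_comm]
  have hi : ∑ i, ∑ j, dx i (fun q => g L q s j) p * p.2 j * p.2 i
      = ∑ j, dx j (dy s (energy L)) p * p.2 j := by
    simp only [← hL.sum_dx_g_mul_snd hp, Finset.sum_mul]
  have hs : ∑ i, ∑ j, dx s (fun q => g L q i j) p * p.2 j * p.2 i = 2 * dx s (energy L) p := by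
    simp only [← hL.sum_dx_dy_energy_mul_snd hp, ← hL.sum_dx_g_mul_snd hp, Finset.sum_mul]
  simp only [firstKind, add_mul, sub_mul, Finset.sum_add_distrib, Finset.sum_sub_distrib, hj, hi,
    hs]
  ring

theorem sum_g_mul_spray (hL : IsLocalFinsler U L) (hp : p ∈ slit U) (r : Fin n) :
    ∑ k, g L p r k * spray L k p
      = 2 * (∑ j, dx j (dy r (energy L)) p * p.2 j - dx r (energy L) p) := by
  simp only [spray_eq_sum_gInv_mul]
  rw [hL.sum_g_mul_sum_gInv hp, hL.sum_firstKind hp]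

theorem sum_spray_mul_dy_energy (hL : IsLocalFinsler U L) (hp : p ∈ slit U) :
    ∑ k, spray L k p * dy k (energy L) p = 2 * ∑ j, dx j (energy L) p * p.2 j := by
  have hlower : ∑ k, spray L k p * dy k (energy L) p
      = ∑ m, (∑ k, g L p m k * spray L k p) * p.2 m := by
    simp only [← hL.sum_g_mul_snd hp, Finset.sum_mul, Finset.mul_sum]
    rw [Finset.sum_comm]
    exact Finset.sum_congr rfl fun m _ => Finset.sum_congr rfl fun k _ => by
      rw [hL.g_symm hp]; ring
  have hEuler : ∑ m, (∑ j, dx j (dy m (energy L)) p * p.2 j) * p.2 m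
      = ∑ j, 2 * dx j (energy L) p * p.2 j := by
    simp only [← hL.sum_dx_dy_energy_mul_snd hp, Finset.sum_mul]
    rw [Finset.sum_comm]
    simp only [mul_right_comm]
  simp only [hlower, hL.sum_g_mul_spray hp, mul_assoc, ← Finset.mul_sum, sub_mul,
    Finset.sum_sub_distrib, hEuler]
  ring

theorem horizontal_energy (hL : IsLocalFinsler U L) (hp : p ∈ slit U) (r : Fin n) :
    horizontal L r (energy L) p = 0 := by
  have hE := hL.contDiffAt_energy hp
  have hdx : ∀ j, DifferentiableAt ℝ (dx j (energy L)) p := fun j =>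
    (contDiffAt_dx hE j).differentiableAt (by simp)
  have hspray : dy r (fun q => ∑ k, spray L k q * dy k (energy L) q) p
      = 4 * ∑ k, nonlin L p k r * dy k (energy L) p + ∑ k, g L p r k * spray L k p := by
    rw [dy_sum_mul (fun k => (hL.contDiffAt_spray hp k).differentiableAt (by simp))
      fun k => (contDiffAt_dy hE k).differentiableAt (by simp), Finset.mul_sum]
    congr 1 <;> refine Finset.sum_congr rfl fun k _ => ?_
    · rw [nonlin_eq_dy_spray]
      ring
    · rw [g_apply, mul_comm]
  have hbase : dy r (fun q => 2 * ∑ j, dx j (energy L) q * q.2 j) p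
      = 2 * (∑ j, dx j (dy r (energy L)) p * p.2 j + dx r (energy L) p) := by
    simp only [dy_const_mul, dy_sum_mul_snd hdx, dy_dx_comm (hE.of_le (by norm_cast))]
  have key := dy_congr (hL.eventuallyEq hp fun _ => hL.sum_spray_mul_dy_energy) r
  rw [hspray, hbase, hL.sum_g_mul_spray hp] at key
  rw [horizontal]
  linarith

theorem horizontal_self (hL : IsLocalFinsler U L) (hp : p ∈ slit U) (r : Fin n) :
    horizontal L r L p = 0 := by
  have key := hL.horizontal_energy hp r
  rw [horizontal_of_fderiv_eq_smul (hL.fderiv_energy hp)] at key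
  exact (mul_eq_zero.1 key).resolve_left (hL.ne_zero hp)

end Spray

section Connections

theorem dy_horizontal (hL : IsLocalFinsler U L) (hp : p ∈ slit U) {h : E n × E n → ℝ}
    (hh : ContDiffAt ℝ ∞ h p) (r j : Fin n) :
    dy j (horizontal L r h) p
      = horizontal L r (dy j h) p - ∑ m, berwald L p m r j * dy m h p := by
  have hN : ∀ m, DifferentiableAt ℝ (fun q => nonlin L q m r) p := fun m =>
    (hL.contDiffAt_nonlin hp m r).differentiableAt (by simp)
  have hdy : ∀ m, DifferentiableAt ℝ (dy m h) p := fun m =>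
    (contDiffAt_dy hh m).differentiableAt (by simp)
  have hcomm := hh.of_le (m := 2) (by norm_cast)
  unfold horizontal
  rw [dy_sub ((contDiffAt_dx hh r).differentiableAt (by simp))
    (DifferentiableAt.fun_sum fun m _ => (hN m).fun_mul (hdy m)), dy_sum_mul hN hdy,
    dy_dx_comm hcomm]
  simp only [dy_dy_comm hcomm j, berwald]
  ring

theorem horizontal_dy_energy (hL : IsLocalFinsler U L) (hp : p ∈ slit U) (r j : Fin n) :
    horizontal L r (dy j (energy L)) p = ∑ m, berwald L p m r j * dy m (energy L) p := by
  have key := dy_congr (hL.eventuallyEq hp fun _ hq => hL.horizontal_energy hq r) j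
  rw [dy_const, hL.dy_horizontal hp (hL.contDiffAt_energy hp)] at key
  exact sub_eq_zero.1 key

theorem landsberg_eq (hL : IsLocalFinsler U L) (hp : p ∈ slit U) (i j k : Fin n) :
    landsberg L p i j k
      = -(1 / 2 : ℝ) * ∑ l, dy l (energy L) p * dy j (fun q => berwald L q l i k) p := by
  simp only [landsberg, hL.sum_g_mul_snd hp]
  rfl

theorem horizontal_g (hL : IsLocalFinsler U L) (hp : p ∈ slit U) (r i j : Fin n) :
    horizontal L r (fun q => g L q i j) p
      = ∑ m, g L p i m * berwald L p m r j + ∑ m, g L p j m * berwald L p m r i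
        - 2 * landsberg L p r i j := by
  have hE := hL.contDiffAt_energy hp
  have hdy : dy i (fun q => ∑ m, berwald L q m r j * dy m (energy L) q) p
      = ∑ m, g L p i m * berwald L p m r j - 2 * landsberg L p r i j := by
    rw [dy_sum_mul (fun m => (hL.contDiffAt_berwald hp m r j).differentiableAt (by simp))
      fun m => (contDiffAt_dy hE m).differentiableAt (by simp), hL.landsberg_eq hp]
    simp only [g_apply, mul_comm (dy _ (energy L) p), mul_comm (dy i (dy _ (energy L)) p)]
    ring
  have hcomm := hL.dy_horizontal hp (contDiffAt_dy hE j) r i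
  rw [dy_congr (hL.eventuallyEq hp fun _ hq => hL.horizontal_dy_energy hq r j), hdy] at hcomm
  simp only [← g_apply, ← g_eq_dy_dy_energy, hL.g_symm hp _ j, mul_comm (berwald L p _ r i)]
    at hcomm
  linarith

theorem berwald_symm (hL : IsLocalFinsler U L) (hp : p ∈ slit U) (k i j : Fin n) :
    berwald L p k i j = berwald L p k j i := by
  have hS := (hL.contDiffAt_spray hp k).of_le (m := 2) (by norm_cast)
  simp only [berwald, nonlin_eq_dy_spray, dy_const_mul]
  rw [dy_dy_comm hS]

theorem landsberg_swap_right (hL : IsLocalFinsler U L) (hp : p ∈ slit U) (i j k : Fin n) :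
    landsberg L p i j k = landsberg L p i k j := by
  simp only [landsberg, dy_dy_comm ((hL.contDiffAt_nonlin hp _ i).of_le (by norm_cast)) j k]

theorem landsberg_swap_left (hL : IsLocalFinsler U L) (hp : p ∈ slit U) (i j k : Fin n) :
    landsberg L p i j k = landsberg L p j i k := by
  rw [hL.landsberg_swap_right hp i, hL.landsberg_swap_right hp j, hL.landsberg_eq hp,
    hL.landsberg_eq hp]
  simp only [dy_congr (hL.eventuallyEq hp fun _ hq => hL.berwald_symm hq _ i j)]

theorem sum_nonlin_div_mul_cartan (hL : IsLocalFinsler U L) (hp : p ∈ slit U) (r i j : Fin n) :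
    ∑ m, nonlin L p m r / L p * cartan L p m i j
      = (1 / 2 : ℝ) * ∑ m, nonlin L p m r * dy m (fun q => g L q i j) p := by
  have hL0 := hL.ne_zero hp
  rw [Finset.mul_sum]
  refine Finset.sum_congr rfl fun m _ => ?_
  rw [hL.cartan_swap hp, hL.cartan_symm hp, cartan]
  field_simp

theorem chern_eq_horizontal (hL : IsLocalFinsler U L) (hp : p ∈ slit U) (k i j : Fin n) :
    chern L p k i j = ∑ s, gInv L p k s * ((1 / 2 : ℝ) *
      (horizontal L j (fun q => g L q s i) p + horizontal L i (fun q => g L q s j) p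
        - horizontal L s (fun q => g L q i j) p)) := by
  rw [chern, Finset.mul_sum, ← Finset.sum_sub_distrib]
  refine Finset.sum_congr rfl fun s _ => ?_
  simp only [Finset.sum_add_distrib, Finset.sum_sub_distrib, hL.sum_nonlin_div_mul_cartan hp,
    firstKind, horizontal]
  ring

theorem chern_eq_berwald_sub_landsberg (hL : IsLocalFinsler U L) (hp : p ∈ slit U)
    (k i j : Fin n) :
    chern L p k i j = berwald L p k i j - ∑ s, gInv L p k s * landsberg L p s i j := by
  rw [hL.chern_eq_horizontal hp, ← hL.sum_gInv_mul_sum_g hp (fun m => berwald L p m i j) k,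
    ← Finset.sum_sub_distrib]
  refine Finset.sum_congr rfl fun s _ => ?_
  have hb : ∀ a b c, ∑ m, g L p a m * berwald L p m b c = ∑ m, g L p a m * berwald L p m c b :=
    fun a b c => Finset.sum_congr rfl fun m _ => by rw [hL.berwald_symm hp]
  have hjsi : landsberg L p j s i = landsberg L p s i j := by
    rw [hL.landsberg_swap_left hp, hL.landsberg_swap_right hp]
  simp only [hL.horizontal_g hp, hjsi, hL.landsberg_swap_left hp i s j, hb s j i, hb i j s,
    hb j i s]
  ring

end Connections

section TensorB

theorem dLog_eq (hL : IsLocalFinsler U L) (hp : p ∈ slit U) (a b : E n × E n → ℝ) (r : Fin n) :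
    dLog L a b p r = b p / L p * hilbert L p r := by
  have hlog : fderiv ℝ (fun q => Real.log (L q)) p = (L p)⁻¹ • fderiv ℝ L p :=
    fderiv.log ((hL.contDiffAt hp).differentiableAt (by simp)) (hL.ne_zero hp)
  have hu : dLog L a b p r = a p * horizontal L r (fun q => Real.log (L q)) p
      + b p * dy r (fun q => Real.log (L q)) p := rfl
  rw [hu, horizontal_of_fderiv_eq_smul hlog, hL.horizontal_self hp, dy, hlog]
  simp only [smul_apply, smul_eq_mul, hilbert, dy]
  ring

theorem chernB_eq (hL : IsLocalFinsler U L) (hp : p ∈ slit U) (a b : E n × E n → ℝ)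
    (k i j : Fin n) : chernB L a b p k i j = -(b p / L p) * cartanUp L p k i j := by
  have hU := hL.sum_cartanUpUp_mul_hilbert hp
  have hUU : ∀ i j, ∑ r, (∑ s, cartanUp L p k i s * cartanUpUp L p s r j) * hilbert L p r = 0 :=
    fun i j => by
      simp only [Finset.sum_mul]
      rw [Finset.sum_comm]
      simp only [mul_assoc, ← Finset.mul_sum, hU, mul_zero, Finset.sum_const_zero]
  have hUU' : ∑ r, (∑ s, cartanUpUp L p r k s * cartanUp L p s i j) * hilbert L p r = 0 := by
    simp only [Finset.sum_mul]
    rw [Finset.sum_comm]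
    simp only [mul_right_comm _ (cartanUp L p _ i j), ← Finset.sum_mul,
      hL.cartanUpUp_symm hp _ k, hU, zero_mul, Finset.sum_const_zero]
  simp only [chernB, hL.dLog_eq hp]
  calc _ = b p / L p * (hilbert L p j * ∑ r, cartanUpUp L p k r i * hilbert L p r
        + hilbert L p i * ∑ r, cartanUpUp L p k r j * hilbert L p r
        - cartanUp L p k i j * ∑ r, hilbertUp L p r * hilbert L p r
        - hilbertUp L p k * ∑ r, cartanUp L p r i j * hilbert L p r
        - ∑ r, (∑ s, cartanUp L p k i s * cartanUpUp L p s r j) * hilbert L p r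
        - ∑ r, (∑ s, cartanUp L p k j s * cartanUpUp L p s r i) * hilbert L p r
        + ∑ r, (∑ s, cartanUpUp L p r k s * cartanUp L p s i j) * hilbert L p r) := by
        simp only [Finset.mul_sum, ← Finset.sum_add_distrib, ← Finset.sum_sub_distrib]
        exact Finset.sum_congr rfl fun r _ => by ring
    _ = _ := by
        rw [hU, hU, hL.sum_hilbertUp_mul_hilbert hp, hL.sum_cartanUp_mul_hilbert hp, hUU, hUU,
          hUU']
        ring

theorem berwaldB_eq (hL : IsLocalFinsler U L) (hp : p ∈ slit U) (a b : E n × E n → ℝ)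
    (k i j : Fin n) : berwaldB L a b p k i j = -(b p / L p) * cartanUp L p k i j := by
  have hU := hL.sum_cartanUpUp_mul_hilbert hp
  simp only [berwaldB, hL.dLog_eq hp, hL.cartanUpUp_symm hp _ k]
  calc _ = b p / L p * (L p * ∑ r, dy j (fun q => cartanUpUp L q k r i) p * hilbert L p r
        + hilbert L p j * ∑ r, cartanUpUp L p k r i * hilbert L p r
        + 2 * hilbert L p i * ∑ r, cartanUpUp L p k r j * hilbert L p r) := by
        simp only [Finset.mul_sum, ← Finset.sum_add_distrib]
        exact Finset.sum_congr rfl fun r _ => by ring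
    _ = _ := by
        rw [hU, hU, hL.mul_sum_dy_cartanUpUp_mul_hilbert hp]
        ring

end TensorB

end IsLocalFinsler

section Manifold

variable {M : Type*} [TopologicalSpace M] [ChartedSpace (E n) M]
  {φ : OpenPartialHomeomorph M (E n)}

theorem lift_snd_ne_zero (hφ : φ ∈ IsManifold.maximalAtlas (𝓡 n) ∞ M) {x y : E n}
    (hx : x ∈ φ.target) (hy : y ≠ 0) : (lift φ (x, y)).2 ≠ 0 := by
  have hd : φ.MDifferentiable (𝓡 n) (𝓡 n) :=
    ⟨(contMDiffOn_of_mem_maximalAtlas hφ).mdifferentiableOn (by simp),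
      (contMDiffOn_symm_of_mem_maximalAtlas hφ).mdifferentiableOn (by simp)⟩
  exact fun h => hy (hd.symm.mfderiv_injective hx (h.trans (map_zero _).symm))

theorem cocycleOp_congr (F : TangentBundle (𝓡 n) M → ℝ) (δ : ℝ)
    {Γ Γ' B B' : OpenPartialHomeomorph M (E n) → E n × E n → Fin n → Fin n → Fin n → ℝ}
    (f : M ≃ₘ^∞⟮𝓡 n, 𝓡 n⟯ M)
    (P : OpenPartialHomeomorph M (E n) → E n → Fin n → Fin n → ℝ) {p : E n × E n}
    (hΓ : Γ φ p = Γ' φ p) (hfΓ : pullback f Γ φ p = pullback f Γ' φ p)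
    (hB : B φ p = B' φ p) (hfB : pullback f B φ p = pullback f B' φ p) (k : Fin n) :
    cocycleOp F δ Γ B f P φ p k = cocycleOp F δ Γ' B' f P φ p k := by
  simp only [pullback] at hfΓ hfB
  simp only [cocycleOp, pullbackOp, pullback, divOp, correction, hΓ, hfΓ, hB, hfB]

variable [IsManifold (𝓡 n) ∞ M]

theorem symm_trans_mem_maximalAtlas (f : M ≃ₘ^∞⟮𝓡 n, 𝓡 n⟯ M)
    (hφ : φ ∈ IsManifold.maximalAtlas (𝓡 n) ∞ M) :
    f.symm.toHomeomorph.toOpenPartialHomeomorph.trans φ ∈ IsManifold.maximalAtlas (𝓡 n) ∞ M := by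
  refine OpenPartialHomeomorph.mem_maximalAtlas_of_contMDiffOn _ ?_ ?_
  · exact (contMDiffOn_of_mem_maximalAtlas hφ).comp f.symm.contMDiff.contMDiffOn
      fun x hx => by simpa using hx
  · exact f.contMDiff.comp_contMDiffOn ((contMDiffOn_symm_of_mem_maximalAtlas hφ).mono
      fun x hx => by simpa using hx)

theorem contMDiffOn_lift (hφ : φ ∈ IsManifold.maximalAtlas (𝓡 n) ∞ M) :
    ContMDiffOn 𝓘(ℝ, E n × E n) (𝓡 n).tangent ∞ (lift φ : E n × E n → TangentBundle (𝓡 n) M)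
      (Prod.fst ⁻¹' φ.target) := by
  have hsymm : ContMDiffOn (𝓡 n).tangent (𝓡 n).tangent ∞ (tangentMap (𝓡 n) (𝓡 n) φ.symm)
      (Bundle.TotalSpace.proj ⁻¹' φ.target) := by
    refine ((contMDiffOn_symm_of_mem_maximalAtlas hφ).contMDiffOn_tangentMapWithin
      (by simp) φ.open_target.uniqueMDiffOn).congr fun v hv => ?_
    exact (tangentMapWithin_eq_tangentMap (φ.open_target.uniqueMDiffOn _ hv)
      ((contMDiffAt_symm_of_mem_maximalAtlas hφ hv).mdifferentiableAt (by simp))).symm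
  have hmodel : ContMDiff 𝓘(ℝ, E n × E n) (𝓡 n).tangent ∞
      (fun p : E n × E n => (⟨p.1, p.2⟩ : TangentBundle (𝓡 n) (E n))) := by
    rw [modelWithCornersSelf_prod]
    exact contMDiff_tangentBundleModelSpaceHomeomorph_symm (I := 𝓡 n) (n := ∞)
  exact hsymm.comp hmodel.contMDiffOn fun _ hp => hp

namespace IsFinsler

variable {F : TangentBundle (𝓡 n) M → ℝ} {p : E n × E n}

theorem isLocalFinsler (hF : IsFinsler F) (hφ : φ ∈ IsManifold.maximalAtlas (𝓡 n) ∞ M) :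
    IsLocalFinsler φ.target (local_ F φ) where
  isOpen := φ.open_target
  smooth := contMDiffOn_iff_contDiffOn.1 <|
    hF.smooth.comp ((contMDiffOn_lift hφ).mono fun _ hp => hp.1)
      fun _ hp => lift_snd_ne_zero hφ hp.1 hp.2
  homogeneous p _ c hc := by
    have hlin := map_smul (mfderiv (𝓡 n) (𝓡 n) φ.symm p.1) c p.2
    exact (congrArg (fun v => F ⟨φ.symm p.1, v⟩) hlin).trans (hF.homogeneous _ _ c hc)
  posDef p hp := hF.posDef φ hφ p.1 hp.1 p.2 hp.2

theorem chern_eq_berwald (hF : IsFinsler F) (hL : IsLandsberg F)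
    (hφ : φ ∈ IsManifold.maximalAtlas (𝓡 n) ∞ M) (hp : p ∈ slit φ.target) :
    chern (local_ F φ) p = berwald (local_ F φ) p := by
  funext k i j
  rw [(hF.isLocalFinsler hφ).chern_eq_berwald_sub_landsberg hp]
  simp [fun s => hL φ hφ p.1 hp.1 p.2 hp.2 s i j]

theorem chernB_eq_berwaldB (hF : IsFinsler F) (a b : E n × E n → ℝ)
    (hφ : φ ∈ IsManifold.maximalAtlas (𝓡 n) ∞ M) (hp : p ∈ slit φ.target) :
    chernB (local_ F φ) a b p = berwaldB (local_ F φ) a b p := by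
  funext k i j
  rw [(hF.isLocalFinsler hφ).chernB_eq hp, (hF.isLocalFinsler hφ).berwaldB_eq hp]

end IsFinsler

end Manifold

end Finsler

theorem proposition4p6 {n : ℕ} {M : Type*} [TopologicalSpace M]
    [ChartedSpace (EuclideanSpace ℝ (Fin n)) M] [IsManifold (𝓡 n) ∞ M]
    (F : TangentBundle (𝓡 n) M → ℝ) (hF : Finsler.IsFinsler F) (hL : Finsler.IsLandsberg F)
    (a b : TangentBundle (𝓡 n) M → ℝ) (δ : ℝ) (f : M ≃ₘ^∞⟮𝓡 n, 𝓡 n⟯ M)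
    (P : OpenPartialHomeomorph M (EuclideanSpace ℝ (Fin n)) →
      EuclideanSpace ℝ (Fin n) → Fin n → Fin n → ℝ)
    (hP : Finsler.IsSymTensorDensity δ P) :
    ∀ φ ∈ IsManifold.maximalAtlas (𝓡 n) ∞ M, ∀ x ∈ φ.target,
      ∀ y : EuclideanSpace ℝ (Fin n), y ≠ 0 → ∀ k : Fin n,
        Finsler.chernOp F a b δ f P φ (x, y) k = Finsler.berwaldOp F a b δ f P φ (x, y) k := by
  intro φ hφ x hx y hy k
  have hφ' := Finsler.symm_trans_mem_maximalAtlas f hφ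
  have hp : (x, y) ∈ Finsler.slit φ.target := ⟨hx, hy⟩
  have hp' : (x, y) ∈ Finsler.slit
      (f.symm.toHomeomorph.toOpenPartialHomeomorph.trans φ).target := ⟨by simpa using hx, hy⟩
  apply Finsler.cocycleOp_congr
  · exact hF.chern_eq_berwald hL hφ hp
  · exact hF.chern_eq_berwald hL hφ' hp'
  · exact hF.chernB_eq_berwaldB _ _ hφ hp
  · exact hF.chernB_eq_berwaldB _ _ hφ' hp'
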